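/- **Setting.** A multi-type language has a set of types, operational connectives (atoms are the nullary ones) and structural connectives, each of finite arity with a type for every coordinate and for the result; every coordinate of a structural connective is positive or negative. Operational terms $a,b,\dots$ are built from operational connectives; structures $x,y,z,\dots$ are built from operational terms by structural connectives; all terms are well-typed, and every term has a unique type. A sequent is a pair $x\vdash y$; it is *type-uniform* if $x$ and $y$ have the same type. A constituent of $x\vdash y$ is a precedent (succedent) part if it lies in $x$ under an even (odd) number of negative coordinates or in $y$ under an odd (even) number of them; it is *in display* if it is all of $x$ or all of $y$. We write $(x\vdash y)[a]^{pre}$, $(x\vdash y)[a]^{suc}$ to mark an occurrence of $a$ in precedent, succedent position, and $[z/a]$ for its replacement by $z$. A multi-type sequent calculus is given by a family of rules. A rule is a set of applications (inferences), each with finitely many premises, a conclusion, and a congruence: an equivalence relation on some of the occurrences of structures in the inference, called its *parameters*. An operational term in the conclusion that is not a parameter is *principal*. An axiom is the conclusion of an application without premises. In addition the calculus has, for all operational terms $a$ and all structures $x,y$ of the type of $a$, the surgical cuts $$\frac{x\vdash a\qquad (z\vdash w)[a]^{pre}}{(z\vdash w)[x/a]^{pre}}\qquad\qquad \frac{(w\vdash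 z)[a]^{suc}\qquad a\vdash y}{(w\vdash z)[y/a]^{suc}}$$ of which the ordinary cut (from $x\vdash a$ and $a\vdash y$ to $x\vdash y$) is a special case. A *display postulate* is a rule with one premise in which every operational term of the premise is congruent to one in the conclusion and vice versa, and whose applications, read upwards, are also applications of a rule of the calculus. **Conditions** (on all applications of the rules other than cut). - C$_1$: every operational term occurring in a premise is a subterm of some operational term occurring in the conclusion. - C$_2$, C$_2'$: congruent parameters are occurrences of the same structure, and have the same type. - C$_3$: each parameter is congruent to at most one constituent of the conclusion. - C$_4$: congruent parameters are all precedent or all succedent parts of their sequents. - C$_5'$: if $a$ is principal in the conclusion of a derivation that does not consist of an axiom only, then $a$ is in display. In an axiom, an operational term is principal at most once in precedent and at most once in succedent position. - C$_5''$: if $a$ is principal in an axiom, then display postulates transform the axiom into an axiom in which this occurrence of $a$ is in display. - C$_5'''$: if $(x\vdash y)([a]^{pre},[a]^{suc})$, $a\vdash z[a]^{suc}$ and $v[a]^{pre}\vdash a$ are axioms, then so are $(x\vdash y)([a]^{pre},[z/a]^{suc})$ and $(x\vdash y)([v/a]^{pre},[a]^{suc})$. - C$_6'$ (C$_7'$):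 if an operational term $a$ in succedent (precedent) position is a parameter of an application of a rule $R$, and $z$ is a structure of the type of $a$, then replacing by $z$ all the occurrences congruent to it gives an application of $R$, in which every operational term that was not replaced is congruent to the same occurrences as before. - C$_8'$: if $x\vdash a$ and $a\vdash y$ have cut-free derivations in whose last inferences the displayed $a$ is principal, then $x\vdash y$ has a derivation in which all cuts are on proper subterms of $a$ (and within one type, as above). - C$_9$: every derivable sequent is type-uniform. - C$_{10}$: the cut rules preserve type-uniformity. **Theorem (cut elimination meta-theorem).** In any multi-type sequent calculus satisfying C$_2$–C$_{10}$, every sequent derivable with (surgical) cuts is derivable without cuts. If C$_1$ also holds, the calculus has the subformula property: every derivable sequent $s$ has a cut-free derivation in which every operational term is a subterm of an operational term occurring in $s$. -/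

import Mathlib

namespace MultiType

universe u v w r

/-- The two positions in a sequent: precedent and succedent. -/
inductive Part where
  | pre
  | suc

/-- The opposite position. -/
def Part.flip : Part → Part
  | .pre => .suc
  | .suc => .pre

/-- A multi-type propositional language. Operational and structural connectives have a finite
arity, a type for each coordinate and a type for the result, so connectives may stay within one
type or connect different types. Atoms are nullary operational connectives. Each coordinate of a
structural connective has a polarity: `strPos f i` says that it is positive. -/
structure Language where
  Ty : Type u
  OpConn : Type v
  opArity : OpConn → ℕ
  opArg : (c : OpConn) → Fin (opArity c) → Ty
  opRes : OpConn → Ty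
  StrConn : Type w
  strArity : StrConn → ℕ
  strArg : (f : StrConn) → Fin (strArity f) → Ty
  strRes : StrConn → Ty
  strPos : (f : StrConn) → Fin (strArity f) → Prop

variable {L : Language.{u, v, w}}

/-- Operational terms (before type checking). -/
inductive Op (L : Language.{u, v, w}) : Type v where
  | app (c : L.OpConn) (args : Fin (L.opArity c) → Op L) : Op L

/-- The type of an operational term. -/
def Op.ty : Op L → L.Ty
  | .app c _ => L.opRes c

/-- Well-typed operational terms. -/
def Op.WellTyped : Op L → Prop
  | .app c args => ∀ i, (args i).ty = L.opArg c i ∧ (args i).WellTyped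

/-- `b` is an immediate subterm of the operational term. -/
def Op.ImmediateSubterm (b : Op L) : Op L → Prop
  | .app _ args => ∃ i, args i = b

/-- `b` is a proper subterm of `a`. -/
def Op.ProperSubterm (b a : Op L) : Prop := Relation.TransGen Op.ImmediateSubterm b a

/-- `b` is a subterm of `a`. -/
def Op.Subterm (b a : Op L) : Prop := Relation.ReflTransGen Op.ImmediateSubterm b a

/-- Structural terms (before type checking), with operational terms as leaves. -/
inductive Str (L : Language.{u, v, w}) : Type (max v w) where
  | op (a : Op L) : Str L
  | node (f : L.StrConn) (args : Fin (L.strArity f) → Str L) : Str L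

/-- The type of a structural term. -/
def Str.ty : Str L → L.Ty
  | .op a => a.ty
  | .node f _ => L.strRes f

/-- Well-typed structural terms. -/
def Str.WellTyped : Str L → Prop
  | .op a => a.WellTyped
  | .node f args => ∀ i, (args i).ty = L.strArg f i ∧ (args i).WellTyped

open Classical in
/-- The substructure of a structure at a path, together with its position, when the whole
structure is in position `k`; `none` if the path leaves the structure. Negative coordinates
exchange precedent and succedent position. -/
noncomputable def Str.sub : Str L → Part → List ℕ → Option (Part × Str L)
  | x, k, [] => some (k, x)
  | .op _, _, _ :: _ => none
  | .node f args, k, i :: p =>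
      if h : i < L.strArity f then
        (args ⟨i, h⟩).sub (if L.strPos f ⟨i, h⟩ then k else k.flip) p
      else none

open Classical in
/-- Replace by `z` every operational term that stands at a path in `P`. -/
noncomputable def Str.replace : Str L → Set (List ℕ) → Str L → Str L
  | .op a, P, z => if [] ∈ P then z else .op a
  | .node f args, P, z => .node f fun i => (args i).replace {p | i.val :: p ∈ P} z

/-- A sequent `ant ⊢ con`. -/
@[ext] structure Sequent (L : Language.{u, v, w}) where
  ant : Str L
  con : Str L

/-- A place in a sequent: the side of the turnstile (`pre` for the left one) and a path in the
structure on that side. -/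
abbrev Place := Part × List ℕ

namespace Sequent

/-- The substructure at a place and its position (precedent or succedent part). -/
noncomputable def sub (s : Sequent L) : Place → Option (Part × Str L)
  | (.pre, p) => s.ant.sub .pre p
  | (.suc, p) => s.con.sub .suc p

/-- Replace by `z` every operational term that stands at a place in `P`. -/
noncomputable def replace (s : Sequent L) (P : Set Place) (z : Str L) : Sequent L :=
  ⟨s.ant.replace {p | (Part.pre, p) ∈ P} z, s.con.replace {p | (Part.suc, p) ∈ P} z⟩

/-- Both sides are well-typed terms. -/
def WellTyped (s : Sequent L) : Prop := s.ant.WellTyped ∧ s.con.WellTyped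

/-- Both sides have the same type. -/
def TypeUniform (s : Sequent L) : Prop := s.ant.ty = s.con.ty

/-- The operational term `a` occurs in `s` (as a constituent). -/
def Occurs (s : Sequent L) (a : Op L) : Prop := ∃ p k, s.sub p = some (k, .op a)

end Sequent

/-- A place in an inference: `none` stands for the conclusion, `some i` for the `i`-th premise. -/
abbrev InfPlace := Option ℕ × Place

/-- The sequent of an inference with premises `prems` and conclusion `concl` at a location. -/
def seqAt (prems : List (Sequent L)) (concl : Sequent L) : Option ℕ → Option (Sequent L)
  | none => some concl
  | some i => prems[i]?

/-- An inference together with its analysis: the relation of congruence between the occurrences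
of structures in it. The parameters are the occurrences that are congruent to themselves, and
congruence is an equivalence relation between parameters; all other occurrences are active. -/
structure Inference (L : Language.{u, v, w}) where
  prems : List (Sequent L)
  concl : Sequent L
  cong : InfPlace → InfPlace → Prop
  cong_symm : ∀ {o o'}, cong o o' → cong o' o
  cong_trans : ∀ {o o' o''}, cong o o' → cong o' o'' → cong o o''
  cong_occ : ∀ {o o'}, cong o o' → ∃ s, seqAt prems concl o.1 = some s ∧ (s.sub o.2).isSome

namespace Inference

/-- The sequent at a location of the inference. -/
def seq (inf : Inference L) (l : Option ℕ) : Option (Sequent L) := seqAt inf.prems inf.concl l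

/-- The structure at a place of the inference, and its position in its sequent. -/
noncomputable def sub (inf : Inference L) (o : InfPlace) : Option (Part × Str L) :=
  (inf.seq o.1).bind fun s => s.sub o.2

/-- Parameters. -/
def Param (inf : Inference L) (o : InfPlace) : Prop := inf.cong o o

/-- The operational term `a`, in position `k`, is principal at the place `p` of the conclusion:
it occurs there and is not a parameter. -/
def Principal (inf : Inference L) (p : Place) (k : Part) (a : Op L) : Prop :=
  inf.concl.sub p = some (k, .op a) ∧ ¬ inf.Param (none, p)

/-- `inf'` arises from `inf` by substituting the structure `z` for all the occurrences that are
congruent to `o`. The operational terms that are not replaced keep their status: they are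
congruent to the same occurrences as before (in particular active ones stay active). -/
def IsSubst (inf : Inference L) (o : InfPlace) (z : Str L) (inf' : Inference L) : Prop :=
  (∀ l, inf'.seq l = (inf.seq l).map fun s => s.replace {p | inf.cong o (l, p)} z) ∧
  ∀ o₁ k b, inf.sub o₁ = some (k, .op b) → ¬ inf.cong o o₁ →
    ∀ o₂, inf'.cong o₁ o₂ ↔ inf.cong o₁ o₂

/-- `inf'` is the one-premise inference `inf` read upwards. -/
def IsConverse (inf inf' : Inference L) : Prop :=
  inf.prems = [inf'.concl] ∧ inf'.prems = [inf.concl] ∧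
  ∀ l p l' p', inf'.cong (l, p) (l', p') ↔
    inf.cong (Equiv.swap none (some 0) l, p) (Equiv.swap none (some 0) l', p')

end Inference

/-- A multi-type sequent calculus: a family of rules, each being the set of its (analysed)
applications, between well-typed sequents. The axioms are the conclusions of the applications
without premises. The cut rules are not listed here; they are added in `Derivable`. -/
structure Calculus (L : Language.{u, v, w}) where
  Rule : Type r
  app : Rule → Set (Inference L)
  wellTyped : ∀ R, ∀ inf ∈ app R, inf.concl.WellTyped ∧ ∀ s ∈ inf.prems, s.WellTyped

/-- The left surgical cut on `a`, from `x ⊢ a` and `(z ⊢ y)[a]ᵖʳᵉ` to `(z ⊢ y)[x/a]ᵖʳᵉ`,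
with `x` and `a` of the same type. The ordinary cut is the case in which `z` is `a`. -/
def LCut (a : Op L) (s₁ s₂ s₃ : Sequent L) : Prop :=
  s₁.con = .op a ∧ s₁.ant.ty = a.ty ∧
  ∃ p, s₂.sub p = some (.pre, .op a) ∧ s₃ = s₂.replace {p} s₁.ant

/-- The right surgical cut on `a`, from `(x ⊢ z)[a]ˢᵘᶜ` and `a ⊢ y` to `(x ⊢ z)[y/a]ˢᵘᶜ`,
with `y` and `a` of the same type. The ordinary cut is the case in which `z` is `a`. -/
def RCut (a : Op L) (s₁ s₂ s₃ : Sequent L) : Prop :=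
  s₂.ant = .op a ∧ s₂.con.ty = a.ty ∧
  ∃ p, s₁.sub p = some (.suc, .op a) ∧ s₃ = s₁.replace {p} s₂.con

namespace Calculus

variable (C : Calculus.{u, v, w, r} L)

/-- Derivability by the rules of the calculus and the cut rules on operational terms in `K`. -/
inductive DerivableCuts (K : Op L → Prop) : Sequent L → Prop where
  | rule (R : C.Rule) (inf : Inference L) (h : inf ∈ C.app R)
      (hp : ∀ s ∈ inf.prems, DerivableCuts K s) : DerivableCuts K inf.concl
  | lcut (a : Op L) (s₁ s₂ s₃ : Sequent L) (ha : K a) (h : LCut a s₁ s₂ s₃)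
      (h₁ : DerivableCuts K s₁) (h₂ : DerivableCuts K s₂) : DerivableCuts K s₃
  | rcut (a : Op L) (s₁ s₂ s₃ : Sequent L) (ha : K a) (h : RCut a s₁ s₂ s₃)
      (h₁ : DerivableCuts K s₁) (h₂ : DerivableCuts K s₂) : DerivableCuts K s₃

/-- Derivability in the calculus with all the cut rules. -/
def Derivable (s : Sequent L) : Prop := C.DerivableCuts (fun _ => True) s

/-- Derivability without cuts. -/
def CutFreeDerivable (s : Sequent L) : Prop := C.DerivableCuts (fun _ => False) s

/-- There is a cut-free derivation of the sequent in which all operational terms satisfy `P`. -/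
inductive CutFreeWithin (P : Op L → Prop) : Sequent L → Prop where
  | rule (R : C.Rule) (inf : Inference L) (h : inf ∈ C.app R)
      (hP : ∀ a, inf.concl.Occurs a → P a)
      (hp : ∀ s ∈ inf.prems, CutFreeWithin P s) : CutFreeWithin P inf.concl

/-- Axioms. -/
def Initial (s : Sequent L) : Prop := ∃ R, ∃ inf ∈ C.app R, inf.prems = [] ∧ inf.concl = s

/-- Display postulates: one-premise rules in which every operational term is a parameter that
occurs in the premise as well as in the conclusion, and which can also be applied upwards. -/
def IsDisplayPostulate (R : C.Rule) : Prop :=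
  ∀ inf ∈ C.app R,
    (∀ p k a, inf.sub (some 0, p) = some (k, .op a) → ∃ q, inf.cong (some 0, p) (none, q)) ∧
    (∀ p k a, inf.sub (none, p) = some (k, .op a) → ∃ q, inf.cong (none, p) (some 0, q)) ∧
    ∃ R', ∃ inf' ∈ C.app R', inf.IsConverse inf'

/-- An application of a display postulate leads from `m.1` to `m'.1`, taking the occurrence at
`m.2` to the occurrence at `m'.2`. -/
def DisplayStep (m m' : Sequent L × Place) : Prop :=
  ∃ R, C.IsDisplayPostulate R ∧ ∃ inf ∈ C.app R,
    inf.prems = [m.1] ∧ inf.concl = m'.1 ∧ inf.cong (some 0, m.2) (none, m'.2)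

/-- Each operational term in a premise is a subterm of one in the conclusion. -/
def PreservesOpTerms : Prop :=
  ∀ R, ∀ inf ∈ C.app R, ∀ s ∈ inf.prems, ∀ b, s.Occurs b →
    ∃ a, inf.concl.Occurs a ∧ b.Subterm a

/-- Congruent parameters are occurrences of the same structure. -/
def ShapeAlike : Prop :=
  ∀ R, ∀ inf ∈ C.app R, ∀ o o', inf.cong o o' →
    (inf.sub o).map Prod.snd = (inf.sub o').map Prod.snd

/-- Congruent parameters have the same type. -/
def TypeAlike : Prop :=
  ∀ R, ∀ inf ∈ C.app R, ∀ o o', inf.cong o o' →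
    (inf.sub o).map (fun x => x.2.ty) = (inf.sub o').map (fun x => x.2.ty)

/-- A parameter is congruent to at most one constituent of the conclusion. -/
def NonProliferation : Prop :=
  ∀ R, ∀ inf ∈ C.app R, ∀ o p q, inf.cong o (none, p) → inf.cong o (none, q) → p = q

/-- Congruent parameters are all precedent or all succedent parts. -/
def PositionAlike : Prop :=
  ∀ R, ∀ inf ∈ C.app R, ∀ o o', inf.cong o o' →
    (inf.sub o).map Prod.fst = (inf.sub o').map Prod.fst

/-- A term that is principal in the conclusion of a derivation which does not consist of an axiom
only is in display, i.e. it is one side of the sequent. -/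
def QuasiDisplay : Prop :=
  ∀ R, ∀ inf ∈ C.app R, inf.prems ≠ [] → (∀ s ∈ inf.prems, C.Derivable s) →
    ∀ p k a, inf.Principal p k a → p.2 = []

/-- In an axiom an operational term is principal at most once in precedent and at most once in
succedent position. -/
def SinglePrincipal : Prop :=
  ∀ R, ∀ inf ∈ C.app R, inf.prems = [] →
    ∀ p q k a, inf.Principal p k a → inf.Principal q k a → p = q

/-- A term that is principal in an axiom can be isolated by display postulates, and the resulting
sequent is again an axiom. -/
def DisplayInvariant : Prop :=
  ∀ R, ∀ inf ∈ C.app R, inf.prems = [] → ∀ p k a, inf.Principal p k a →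
    ∃ s' q, Relation.ReflTransGen C.DisplayStep (inf.concl, p) (s', q) ∧ q.2 = [] ∧ C.Initial s'

/-- Closure of axioms under surgical cut. -/
def AxiomsCutClosed : Prop :=
  ∀ (s : Sequent L) (a : Op L) (z v : Str L) (p q p' q' : Place),
    C.Initial s → s.sub p = some (.pre, .op a) → s.sub q = some (.suc, .op a) →
    C.Initial ⟨.op a, z⟩ → q'.1 = .suc → Sequent.sub ⟨.op a, z⟩ q' = some (.suc, .op a) →
    C.Initial ⟨v, .op a⟩ → p'.1 = .pre → Sequent.sub ⟨v, .op a⟩ p' = some (.pre, .op a) →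
    C.Initial (s.replace {q} z) ∧ C.Initial (s.replace {p} v)

/-- Each rule is closed under substitution of a structure for congruent operational terms in
position `k`, within each type. -/
def ClosedUnderSubst (k : Part) : Prop :=
  ∀ R, ∀ inf ∈ C.app R, ∀ o a, inf.Param o → inf.sub o = some (k, .op a) →
    ∀ z : Str L, z.WellTyped → z.ty = a.ty → ∃ inf' ∈ C.app R, inf.IsSubst o z inf'

/-- Eliminability of matching principal constituents: if `x ⊢ a` and `a ⊢ y` have cut-free
derivations whose last inferences have the displayed `a` as a principal term, then `x ⊢ y` has a
derivation in which all cuts are on proper subterms of `a` (and within one type). -/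
def PrincipalCutsReduce : Prop :=
  ∀ (x y : Str L) (a : Op L),
    ∀ R₁, ∀ inf₁ ∈ C.app R₁, ∀ R₂, ∀ inf₂ ∈ C.app R₂,
    inf₁.concl = ⟨x, .op a⟩ → inf₁.Principal (.suc, []) .suc a →
    (∀ s ∈ inf₁.prems, C.CutFreeDerivable s) →
    inf₂.concl = ⟨.op a, y⟩ → inf₂.Principal (.pre, []) .pre a →
    (∀ s ∈ inf₂.prems, C.CutFreeDerivable s) →
    C.DerivableCuts (fun b => b.ProperSubterm a) ⟨x, y⟩

/-- Each derivable sequent is type-uniform. -/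
def DerivableTypeUniform : Prop := ∀ s, C.Derivable s → s.TypeUniform

/-- Each derivable sequent has a cut-free derivation in which every operational term is a subterm
of some operational term of the sequent. -/
def SubformulaProperty : Prop :=
  ∀ s, C.Derivable s → C.CutFreeWithin (fun b => ∃ a, s.Occurs a ∧ b.Subterm a) s

end Calculus

/-- The cut rules preserve type-uniformity. -/
def CutsPreserveTypeUniformity (L : Language.{u, v, w}) : Prop :=
  ∀ (a : Op L) (s₁ s₂ s₃ : Sequent L), LCut a s₁ s₂ s₃ ∨ RCut a s₁ s₂ s₃ →
    s₁.TypeUniform → s₂.TypeUniform → s₃.TypeUniform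

end MultiType

/-! Cuts are eliminated by well-founded induction on the cut term `a`, ordered by proper subterms.
Everything rests on `replace_cutFree`: to replace occurrences of `a` by `z` in a cut-free
derivation, it is enough to do so where `a` is displayed and principal. Occurrences that are
parameters are traced upwards along congruence and replaced throughout (C₆', C₇'). Tracing stops
where `a` is principal: there it is in display, or, in an axiom, display postulates put it in
display and can be undone after the replacement. In `cut_admissible` this lemma is applied once to
each premise of a cut. What remains is a cut on a term that is displayed and principal on both
sides. C₈' turns it into cuts on proper subterms, which the induction hypothesis removes. -/

namespace MultiType

universe u v w r

variable {L : Language.{u, v, w}}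

/-! ### Replacement of leaves in structures and sequents -/

namespace Str

theorem replace_empty (x z : Str L) : x.replace ∅ z = x := by
  induction x with
  | op a => simp [replace]
  | node f args ih => simpa [replace] using funext ih

theorem sub_replace_of_notMem {b : Op L} {j : Part} (z x : Str L) :
    ∀ (P : Set (List ℕ)) (k : Part) (p : List ℕ), x.sub k p = some (j, .op b) → p ∉ P →
      (x.replace P z).sub k p = some (j, .op b) := by
  induction x with
  | op a =>
    intro P k p h hp
    cases p with
    | nil => simpa [replace, hp] using h
    | cons i p => simp [sub] at h
  | node f args ih =>
    intro P k p h hp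
    cases p with
    | nil => simp [sub] at h
    | cons i p =>
      by_cases hi : i < L.strArity f
      · simp only [sub, hi, dite_true, replace] at h ⊢
        exact ih _ _ _ _ h hp
      · simp [sub, hi] at h

/-- The paths in `Q` lead to leaves of the original `x` that the first replacement leaves alone, so
the second one never acts inside an inserted copy of `z`. -/
theorem replace_replace (z x : Str L) :
    ∀ (P Q : Set (List ℕ)) (k : Part),
      (∀ p ∈ Q, (∃ j b, x.sub k p = some (j, .op b)) ∧ p ∉ P) →
      (x.replace P z).replace Q z = x.replace (P ∪ Q) z := by
  induction x with
  | op a =>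
    intro P Q k h
    by_cases hP : [] ∈ P
    · have hQ : Q = ∅ := by
        refine Set.eq_empty_of_forall_notMem fun p hp => ?_
        obtain ⟨⟨j, b, hb⟩, hn⟩ := h p hp
        cases p with
        | nil => exact hn hP
        | cons i p => simp [sub] at hb
      simp [replace, hP, hQ, replace_empty]
    · have hPQ : [] ∈ P ∪ Q ↔ [] ∈ Q := by simp [hP]
      by_cases hQ : [] ∈ Q
      · simp [replace, hP, hQ, hPQ.2 hQ]
      · simp [replace, hP, hQ, mt hPQ.1 hQ]
  | node f args ih =>
    intro P Q k h
    simp only [replace]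
    congr 1
    funext i
    refine ih i _ _ (open Classical in if L.strPos f i then k else k.flip) fun p hp => ?_
    obtain ⟨⟨j, b, hb⟩, hn⟩ := h _ hp
    exact ⟨⟨j, b, by simpa [sub, i.2] using hb⟩, hn⟩

/-- Finiteness allows parameters to be substituted for one congruence class at a time. -/
theorem finite_setOf_sub (x : Str L) : ∀ k : Part, {p | (x.sub k p).isSome}.Finite := by
  induction x with
  | op a =>
    intro k
    refine (Set.finite_singleton []).subset fun p hp => ?_
    cases p with
    | nil => rfl
    | cons i p => simp [sub] at hp
  | node f args ih =>
    intro k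
    refine ((Set.finite_singleton []).union (Set.finite_iUnion fun i : Fin (L.strArity f) =>
      (ih i (open Classical in if L.strPos f i then k else k.flip)).image
        (List.cons i.val))).subset fun p hp => ?_
    cases p with
    | nil => exact Or.inl rfl
    | cons i p =>
      by_cases hi : i < L.strArity f
      · exact Or.inr (Set.mem_iUnion.2 ⟨⟨i, hi⟩, p, by simpa [sub, hi] using hp, rfl⟩)
      · simp [sub, hi] at hp

end Str

namespace Sequent

theorem replace_empty (s : Sequent L) (z : Str L) : s.replace ∅ z = s := by
  simp only [replace, Set.mem_empty_iff_false, Set.ofPred_false, Str.replace_empty]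

theorem sub_replace_of_notMem {s : Sequent L} {P : Set Place} {p : Place} {j : Part} {b : Op L}
    (z : Str L) (h : s.sub p = some (j, .op b)) (hp : p ∉ P) :
    (s.replace P z).sub p = some (j, .op b) := by
  obtain ⟨_ | _, p⟩ := p
  · exact Str.sub_replace_of_notMem z s.ant _ _ _ h hp
  · exact Str.sub_replace_of_notMem z s.con _ _ _ h hp

theorem replace_replace (s : Sequent L) (P Q : Set Place) (z : Str L)
    (h : ∀ p ∈ Q, (∃ j b, s.sub p = some (j, .op b)) ∧ p ∉ P) :
    (s.replace P z).replace Q z = s.replace (P ∪ Q) z :=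
  Sequent.ext (Str.replace_replace z s.ant _ _ .pre fun p hp => h (.pre, p) hp)
    (Str.replace_replace z s.con _ _ .suc fun p hp => h (.suc, p) hp)

theorem finite_setOf_sub (s : Sequent L) : {p | (s.sub p).isSome}.Finite := by
  refine (((s.ant.finite_setOf_sub .pre).image (Prod.mk Part.pre)).union
    ((s.con.finite_setOf_sub .suc).image (Prod.mk Part.suc))).subset ?_
  rintro ⟨_ | _, p⟩ hp
  · exact Or.inl ⟨p, hp, rfl⟩
  · exact Or.inr ⟨p, hp, rfl⟩

theorem eq_of_sub_nil {s : Sequent L} {p : Place} {k : Part} {x : Str L}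
    (h : s.sub p = some (k, x)) (hp : p.2 = []) : p = (k, []) := by
  obtain ⟨_ | _, p⟩ := p <;> obtain rfl : p = [] := hp <;> simp_all [sub, Str.sub]

theorem replace_con {x z : Str L} {a : Op L} :
    (⟨x, .op a⟩ : Sequent L).replace {(.suc, [])} z = ⟨x, z⟩ := by
  simp only [replace, Set.mem_singleton_iff, Prod.mk.injEq, reduceCtorEq, false_and,
    Set.ofPred_false, Str.replace_empty, true_and]
  simp [Str.replace]

theorem replace_ant {y z : Str L} {a : Op L} :
    (⟨.op a, y⟩ : Sequent L).replace {(.pre, [])} z = ⟨z, y⟩ := by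
  simp only [replace, Set.mem_singleton_iff, Prod.mk.injEq, reduceCtorEq, false_and,
    Set.ofPred_false, Str.replace_empty, true_and]
  simp [Str.replace]

theorem con_eq_of_sub {s : Sequent L} {x : Str L} {k : Part}
    (h : s.sub (.suc, []) = some (k, x)) : s = ⟨s.ant, x⟩ := by
  obtain ⟨s, t⟩ := s
  simp_all [sub, Str.sub]

theorem ant_eq_of_sub {s : Sequent L} {x : Str L} {k : Part}
    (h : s.sub (.pre, []) = some (k, x)) : s = ⟨x, s.con⟩ := by
  obtain ⟨s, t⟩ := s
  simp_all [sub, Str.sub]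

end Sequent

namespace Inference

theorem sub_none (inf : Inference L) (p : Place) : inf.sub (none, p) = inf.concl.sub p := rfl

theorem concl_eq_of_seq {inf inf' : Inference L} {F : Option ℕ → Sequent L → Sequent L}
    (h : ∀ l, inf'.seq l = (inf.seq l).map (F l)) : inf'.concl = F none inf.concl := by
  simpa [seq, seqAt] using h none

theorem prems_of_seq {inf inf' : Inference L} {F : Option ℕ → Sequent L → Sequent L}
    (h : ∀ l, inf'.seq l = (inf.seq l).map (F l)) {s : Sequent L} (hs : s ∈ inf'.prems) :
    ∃ i, ∃ t ∈ inf.prems, inf.seq (some i) = some t ∧ s = F (some i) t := by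
  obtain ⟨i, hi⟩ := List.mem_iff_getElem?.1 hs
  have h' := h (some i)
  rw [show inf'.seq (some i) = some s from hi, eq_comm, Option.map_eq_some_iff] at h'
  obtain ⟨t, ht, rfl⟩ := h'
  exact ⟨i, t, List.mem_of_getElem? ht, ht, rfl⟩

end Inference

/-! ### Substitution for parameters of an inference -/

namespace Calculus

variable {C : Calculus.{u, v, w, r} L}

theorem sub_eq_of_cong (shape : C.ShapeAlike) (position : C.PositionAlike) {R : C.Rule}
    {inf : Inference L} (hinf : inf ∈ C.app R) {o o' : InfPlace} {k : Part} {x : Str L}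
    (h : inf.cong o o') (ho : inf.sub o = some (k, x)) : inf.sub o' = some (k, x) := by
  have h₁ := shape R inf hinf o o' h
  have h₂ := position R inf hinf o o' h
  rw [ho] at h₁ h₂
  match h' : inf.sub o' with
  | none => simp [h'] at h₁
  | some (j, y) => simp_all

/-- Substitution of a structure for several parameters of the conclusion at once. -/
theorem exists_subst_finset (shape : C.ShapeAlike) (nonprolif : C.NonProliferation)
    (position : C.PositionAlike) {k : Part} (closed : C.ClosedUnderSubst k) {R : C.Rule}
    {inf : Inference L} (hinf : inf ∈ C.app R) {a : Op L} {z : Str L} (hz : z.WellTyped)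
    (hty : z.ty = a.ty) (T : Finset Place)
    (hT : ∀ p ∈ T, inf.Param (none, p) ∧ inf.concl.sub p = some (k, .op a)) :
    ∃ inf' ∈ C.app R,
      (∀ l, inf'.seq l =
        (inf.seq l).map fun s => s.replace {q | ∃ p ∈ T, inf.cong (none, p) (l, q)} z) ∧
      ∀ o₁ j b, inf.sub o₁ = some (j, .op b) → (∀ p ∈ T, ¬ inf.cong (none, p) o₁) →
        ∀ o₂, inf'.cong o₁ o₂ ↔ inf.cong o₁ o₂ := by
  classical
  induction T using Finset.induction_on with
  | empty =>
    refine ⟨inf, hinf, fun l => ?_, fun _ _ _ _ _ _ => Iff.rfl⟩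
    simp [Sequent.replace_empty]
  | insert p T hpT ih =>
    obtain ⟨inf', hinf', hseq, hcong⟩ := ih fun q hq => hT q (Finset.mem_insert_of_mem hq)
    obtain ⟨hpar, hsub⟩ := hT p (Finset.mem_insert_self _ _)
    -- By C₃ distinct places of the conclusion are never congruent. So the earlier substitutions
    -- miss the class of `p`, which is the same in `inf'` as in `inf`.
    have hsep : ∀ q ∈ T, ¬ inf.cong (none, q) (none, p) := fun q hq hc =>
      hpT (nonprolif R inf hinf _ _ _ (hT q (Finset.mem_insert_of_mem hq)).1 hc ▸ hq)
    have hpc := hcong (none, p) k a hsub hsep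
    have hsub' : ∀ o j b, inf.sub o = some (j, .op b) → (∀ q ∈ T, ¬ inf.cong (none, q) o) →
        inf'.sub o = some (j, .op b) := by
      intro o j b ho hn
      obtain ⟨s, hs, hso⟩ := Option.bind_eq_some_iff.1 ho
      refine Option.bind_eq_some_iff.2 ⟨_, by rw [hseq, hs]; rfl, ?_⟩
      exact Sequent.sub_replace_of_notMem z hso fun ⟨q, hq, hc⟩ => hn q hq hc
    obtain ⟨inf'', hinf'', hseq', hcong'⟩ := closed R inf' hinf' (none, p) a
      ((hpc _).2 hpar) (hsub' _ _ _ hsub hsep) z hz hty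
    refine ⟨inf'', hinf'', fun l => ?_, fun o₁ j b ho hn o₂ => ?_⟩
    · rw [hseq', hseq, Option.map_map]
      cases hl : inf.seq l with
      | none => rfl
      | some s =>
        simp only [Option.map_some, Function.comp_apply, Option.some.injEq, hpc]
        rw [Sequent.replace_replace]
        · congr 1
          ext q
          simp [or_comm]
        · intro q hq
          have hq' := sub_eq_of_cong shape position hinf hq hsub
          refine ⟨⟨k, a, by simpa [Inference.sub, hl] using hq'⟩, fun ⟨p', hp', hc⟩ => ?_⟩
          exact hsep p' hp' (inf.cong_trans hc (inf.cong_symm hq))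
    · have hn' : ∀ q ∈ T, ¬ inf.cong (none, q) o₁ := fun q hq =>
        hn q (Finset.mem_insert_of_mem hq)
      rw [hcong' o₁ j b (hsub' _ _ _ ho hn')
        (fun hc => hn p (Finset.mem_insert_self _ _) ((hpc _).1 hc)), hcong o₁ j b ho hn']

theorem DerivableCuts.mono {K K' : Op L → Prop} (hK : ∀ a, K a → K' a) {s : Sequent L}
    (h : C.DerivableCuts K s) : C.DerivableCuts K' s := by
  induction h with
  | rule R inf h _ ih => exact .rule R inf h ih
  | lcut a s₁ s₂ s₃ ha h _ _ ih₁ ih₂ => exact .lcut a s₁ s₂ s₃ (hK a ha) h ih₁ ih₂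
  | rcut a s₁ s₂ s₃ ha h _ _ ih₁ ih₂ => exact .rcut a s₁ s₂ s₃ (hK a ha) h ih₁ ih₂

theorem CutFreeDerivable.derivable {s : Sequent L} (h : C.CutFreeDerivable s) : C.Derivable s :=
  DerivableCuts.mono (fun _ h => h.elim) h

theorem CutFreeDerivable.wellTyped {s : Sequent L} (h : C.CutFreeDerivable s) :
    s.WellTyped := by
  cases h with
  | rule R inf h _ => exact (C.wellTyped R inf h).1
  | lcut _ _ _ _ ha => exact ha.elim
  | rcut _ _ _ _ ha => exact ha.elim

/-! ### Display postulates and principal terms of axioms -/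

theorem DisplayStep.sub_eq (shape : C.ShapeAlike) (position : C.PositionAlike)
    {m m' : Sequent L × Place} (h : C.DisplayStep m m') {k : Part} {x : Str L}
    (hm : m.1.sub m.2 = some (k, x)) : m'.1.sub m'.2 = some (k, x) := by
  obtain ⟨R, -, inf, hinf, hprem, hconcl, hc⟩ := h
  have := sub_eq_of_cong shape position hinf hc (k := k) (x := x)
    (by simpa [Inference.sub, Inference.seq, seqAt, hprem] using hm)
  rwa [Inference.sub_none, hconcl] at this

/-- After replacement of the displayed occurrence, a display step can be undone. -/
theorem DisplayStep.replace_cutFree (nonprolif : C.NonProliferation) {k : Part}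
    (closed : C.ClosedUnderSubst k) {a : Op L} {z : Str L} (hz : z.WellTyped) (hty : z.ty = a.ty)
    {m m' : Sequent L × Place} (h : C.DisplayStep m m') (hm : m.1.sub m.2 = some (k, .op a))
    (hd : C.CutFreeDerivable (m'.1.replace {m'.2} z)) :
    C.CutFreeDerivable (m.1.replace {m.2} z) := by
  obtain ⟨R, hR, inf, hinf, hprem, hconcl, hc⟩ := h
  obtain ⟨-, -, R', inf', hinf', hpi, hpi', hcong⟩ := hR inf hinf
  have hconcl' : inf'.concl = m.1 := by simpa [hprem, eq_comm] using hpi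
  have hc' : inf'.cong (none, m.2) (some 0, m'.2) := by
    rw [hcong]
    simpa using hc
  have hpar : inf'.Param (none, m.2) := inf'.cong_trans hc' (inf'.cong_symm hc')
  -- The substitution is made in the upward reading `inf'`, whose premise is `m'.1` and whose
  -- conclusion is `m.1`.
  obtain ⟨inf'', hinf'', hseq, -⟩ := closed R' inf' hinf' (none, m.2) a hpar
    (by rw [Inference.sub_none, hconcl', hm]) z hz hty
  have hcl : inf''.concl = m.1.replace {m.2} z := by
    rw [Inference.concl_eq_of_seq hseq, hconcl']
    congr 1
    ext q
    exact ⟨fun h => nonprolif R' inf' hinf' _ _ _ h hpar, fun h => by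
      obtain rfl : q = m.2 := h
      exact hpar⟩
  rw [← hcl]
  refine .rule R' inf'' hinf'' fun s hs => ?_
  obtain ⟨i, t, ht, hi, rfl⟩ := Inference.prems_of_seq hseq hs
  rw [hpi', List.mem_singleton] at ht
  obtain rfl : i = 0 := by
    by_contra hne
    obtain ⟨n, rfl⟩ := Nat.exists_eq_succ_of_ne_zero hne
    simp [Inference.seq, seqAt, hpi'] at hi
  rw [ht, hconcl]
  -- The premise of `inf'` is the conclusion of `inf`, so C₃ for `inf` shows that only `m'.2` is
  -- replaced there.
  refine (congrArg (fun Q => C.CutFreeDerivable (m'.1.replace Q z)) (Set.ext fun q => ?_)).mpr hd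
  refine ⟨fun h => ?_, fun h => ?_⟩
  · have h' := (hcong _ _ _ _).1 h
    simp only [Equiv.swap_apply_left, Equiv.swap_apply_right] at h'
    exact nonprolif R inf hinf _ _ _ h' hc
  · obtain rfl : q = m'.2 := h
    exact hc'

/-- Replacement in an axiom of one occurrence that is principal in it. -/
theorem replace_initial_cutFree (shape : C.ShapeAlike) (nonprolif : C.NonProliferation)
    (position : C.PositionAlike) (displayInv : C.DisplayInvariant) {k : Part}
    (closed : C.ClosedUnderSubst k) {a : Op L} {z : Str L} (hz : z.WellTyped) (hty : z.ty = a.ty)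
    (hprin : ∀ R, ∀ inf ∈ C.app R, (∀ s ∈ inf.prems, C.CutFreeDerivable s) →
      inf.Principal (k, []) k a → C.CutFreeDerivable (inf.concl.replace {(k, [])} z))
    {R : C.Rule} {inf : Inference L} (hinf : inf ∈ C.app R) (hnil : inf.prems = [])
    {p : Place} (hp : inf.Principal p k a) :
    C.CutFreeDerivable (inf.concl.replace {p} z) := by
  obtain ⟨s', q, hsteps, hq, R₂, inf₂, hinf₂, hnil₂, rfl⟩ := displayInv R inf hinf hnil p k a hp
  suffices H : inf₂.concl.sub q = some (k, .op a) → C.CutFreeDerivable (inf₂.concl.replace {q} z) by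
    have : ∀ m : Sequent L × Place, Relation.ReflTransGen C.DisplayStep m (inf₂.concl, q) →
        m.1.sub m.2 = some (k, .op a) → C.CutFreeDerivable (m.1.replace {m.2} z) := by
      intro m hm
      induction hm using Relation.ReflTransGen.head_induction_on with
      | refl => exact H
      | head h _ ih =>
        exact fun hs => h.replace_cutFree nonprolif closed hz hty hs
          (ih (h.sub_eq shape position hs))
    exact this _ hsteps hp.1
  intro hs
  -- The displayed `a` need not be principal in the application that yields the new axiom. If it is
  -- a parameter, substitution gives an axiom at once.
  by_cases hpar : inf₂.Param (none, q)
  · obtain ⟨inf₃, hinf₃, hseq, -⟩ := closed R₂ inf₂ hinf₂ (none, q) a hpar hs z hz hty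
    have hcl : inf₃.concl = inf₂.concl.replace {q} z := by
      rw [Inference.concl_eq_of_seq hseq]
      congr 1
      ext q'
      exact ⟨fun h => nonprolif R₂ inf₂ hinf₂ _ _ _ h hpar, fun h => by
        obtain rfl : q' = q := h
        exact hpar⟩
    rw [← hcl]
    refine .rule R₂ inf₃ hinf₃ fun s hs => ?_
    obtain ⟨i, t, ht, -⟩ := Inference.prems_of_seq hseq hs
    simp [hnil₂] at ht
  · obtain rfl := Sequent.eq_of_sub_nil hs hq
    exact hprin R₂ inf₂ hinf₂ (by simp [hnil₂]) ⟨hs, hpar⟩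

/-! ### Replacement throughout a cut-free derivation -/

/-- If a structure can replace `a` wherever `a` is displayed and principal, then it can replace
any occurrences of `a` in the given position. -/
theorem replace_cutFree (shape : C.ShapeAlike) (nonprolif : C.NonProliferation)
    (position : C.PositionAlike) (quasiDisplay : C.QuasiDisplay) (single : C.SinglePrincipal)
    (displayInv : C.DisplayInvariant) {k : Part} (closed : C.ClosedUnderSubst k)
    {a : Op L} {z : Str L} (hz : z.WellTyped) (hty : z.ty = a.ty)
    (hprin : ∀ R, ∀ inf ∈ C.app R, (∀ s ∈ inf.prems, C.CutFreeDerivable s) →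
      inf.Principal (k, []) k a → C.CutFreeDerivable (inf.concl.replace {(k, [])} z))
    {s : Sequent L} (hs : C.CutFreeDerivable s) :
    ∀ P : Set Place, (∀ p ∈ P, s.sub p = some (k, .op a)) →
      C.CutFreeDerivable (s.replace P z) := by
  classical
  unfold CutFreeDerivable at hs
  induction hs with
  | lcut _ _ _ _ ha => exact ha.elim
  | rcut _ _ _ _ ha => exact ha.elim
  | rule R inf hinf _ ih =>
    intro P hP
    have hfin : {p | p ∈ P ∧ inf.Param (none, p)}.Finite :=
      inf.concl.finite_setOf_sub.subset fun p hp => by simp [hP p hp.1]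
    have hmem : ∀ p, p ∈ hfin.toFinset ↔ p ∈ P ∧ inf.Param (none, p) := by simp
    obtain ⟨inf', hinf', hseq, hcong⟩ := exists_subst_finset shape nonprolif position closed hinf
      hz hty hfin.toFinset fun p hp => ⟨((hmem p).1 hp).2, hP p ((hmem p).1 hp).1⟩
    -- One parameter of the conclusion may be congruent to several occurrences in a premise, as in
    -- contraction; hence the induction over arbitrary sets `P`.
    have hprems : ∀ s ∈ inf'.prems, C.CutFreeDerivable s := by
      intro s hs
      obtain ⟨i, t, ht, hi, rfl⟩ := Inference.prems_of_seq hseq hs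
      refine ih t ht _ fun q ⟨p, hp, hc⟩ => ?_
      have := sub_eq_of_cong shape position hinf hc (hP p ((hmem p).1 hp).1)
      simpa [Inference.sub, hi] using this
    set Q : Set Place := {p | p ∈ P ∧ ¬ inf.Param (none, p)} with hQ
    have hconcl : inf'.concl = inf.concl.replace {p | p ∈ P ∧ inf.Param (none, p)} z := by
      rw [Inference.concl_eq_of_seq hseq]
      congr 1
      ext q
      refine ⟨fun ⟨p, hp, hc⟩ => ?_, fun hq => ⟨q, (hmem q).2 hq, hq.2⟩⟩
      rw [← nonprolif R inf hinf _ _ _ ((hmem p).1 hp).2 hc]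
      exact (hmem p).1 hp
    have hrep : inf.concl.replace P z = inf'.concl.replace Q z := by
      rw [hconcl, Sequent.replace_replace]
      · congr 1
        ext p
        by_cases h : inf.Param (none, p) <;> simp [hQ, h]
      · exact fun p hp => ⟨⟨k, a, hP p hp.1⟩, fun h => hp.2 h.2⟩
    -- A place that is not a parameter is congruent to nothing, so it is not replaced, and
    -- substitution keeps it active.
    have hQprin : ∀ p ∈ Q, inf'.Principal p k a := by
      intro p hp
      refine ⟨?_, ?_⟩
      · rw [hconcl]
        exact Sequent.sub_replace_of_notMem z (hP p hp.1) fun h => hp.2 h.2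
      · unfold Inference.Param
        rw [hcong (none, p) k a (hP p hp.1)]
        · exact hp.2
        · exact fun q _ hc => hp.2 (inf.cong_trans (inf.cong_symm hc) hc)
    rw [hrep]
    rcases Q.eq_empty_or_nonempty with hQe | ⟨p, hp⟩
    · rw [hQe, Sequent.replace_empty]
      exact .rule R inf' hinf' hprems
    by_cases hnil : inf'.prems = []
    · have : Q = {p} := Set.eq_singleton_iff_unique_mem.2 ⟨hp, fun q hq =>
        single R inf' hinf' hnil q p k a (hQprin q hq) (hQprin p hp)⟩
      rw [this]
      exact replace_initial_cutFree shape nonprolif position displayInv closed hz hty hprin hinf'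
        hnil (hQprin p hp)
    -- C₅' speaks of conclusions of derivations, so it applies to `inf'` because its premises are
    -- already known to be derivable. The position `k` then determines the side of the turnstile.
    · have hdisp : ∀ q ∈ Q, q = (k, []) := fun q hq =>
        Sequent.eq_of_sub_nil (hQprin q hq).1 (quasiDisplay R inf' hinf' hnil
          (fun s hs => (hprems s hs).derivable) q k a (hQprin q hq))
      obtain rfl := hdisp p hp
      rw [Set.eq_singleton_iff_unique_mem.2 ⟨hp, hdisp⟩]
      exact hprin R inf' hinf' hprems (hQprin _ hp)

/-- Cuts are removed from the top down, so each one meets cut-free premises. This serves both the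
proper-subterm cuts produced by C₈' and the final elimination of all cuts. -/
theorem cutFree_of_derivableCuts {K : Op L → Prop}
    (hK : ∀ a, K a → ∀ s₁ s₂ s₃, LCut a s₁ s₂ s₃ ∨ RCut a s₁ s₂ s₃ → C.CutFreeDerivable s₁ →
      C.CutFreeDerivable s₂ → C.CutFreeDerivable s₃)
    {s : Sequent L} (h : C.DerivableCuts K s) : C.CutFreeDerivable s := by
  induction h with
  | rule R inf h _ ih => exact .rule R inf h ih
  | lcut a s₁ s₂ s₃ ha h _ _ ih₁ ih₂ => exact hK a ha s₁ s₂ s₃ (.inl h) ih₁ ih₂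
  | rcut a s₁ s₂ s₃ ha h _ _ ih₁ ih₂ => exact hK a ha s₁ s₂ s₃ (.inr h) ih₁ ih₂

end Calculus

theorem Op.properSubterm_wellFounded : WellFounded (Op.ProperSubterm (L := L)) := by
  refine WellFounded.transGen ⟨fun a => ?_⟩
  induction a with
  | app c args ih =>
    refine ⟨_, fun b hb => ?_⟩
    obtain ⟨i, rfl⟩ := hb
    exact ih i

/-! ### Admissibility of cut and the subformula property -/

namespace Calculus

variable {C : Calculus.{u, v, w, r} L}

theorem cut_admissible (shape : C.ShapeAlike) (nonprolif : C.NonProliferation)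
    (position : C.PositionAlike) (quasiDisplay : C.QuasiDisplay) (single : C.SinglePrincipal)
    (displayInv : C.DisplayInvariant) (substSuc : C.ClosedUnderSubst .suc)
    (substPre : C.ClosedUnderSubst .pre) (principal : C.PrincipalCutsReduce)
    (uniform : C.DerivableTypeUniform) (a : Op L) :
    ∀ s₁ s₂ s₃, LCut a s₁ s₂ s₃ ∨ RCut a s₁ s₂ s₃ → C.CutFreeDerivable s₁ →
      C.CutFreeDerivable s₂ → C.CutFreeDerivable s₃ := by
  induction a using Op.properSubterm_wellFounded.induction with
  | _ a ih =>
  -- Here `a` is displayed and principal in the right premise only; replacement in `x ⊢ a` leads to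
  -- the case where it is so in both. C₉ gives the type equality that substitution needs.
  have right : ∀ R, ∀ inf ∈ C.app R, (∀ s ∈ inf.prems, C.CutFreeDerivable s) →
      inf.Principal (.pre, []) .pre a → ∀ x, C.CutFreeDerivable ⟨x, .op a⟩ →
      C.CutFreeDerivable ⟨x, inf.concl.con⟩ := by
    intro R inf hinf hprems hp x hx
    have hd : C.CutFreeDerivable inf.concl := .rule R inf hinf hprems
    have hc := Sequent.ant_eq_of_sub hp.1
    have hu := uniform _ hd.derivable
    rw [hc] at hu
    have := replace_cutFree shape nonprolif position quasiDisplay single displayInv substSuc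
      (a := a) hd.wellTyped.2 hu.symm ?_ hx {(.suc, [])} (by simp [Sequent.sub, Str.sub])
    · rwa [Sequent.replace_con] at this
    · intro R₁ inf₁ hinf₁ hprems₁ hp₁
      have hc₁ := Sequent.con_eq_of_sub hp₁.1
      rw [hc₁, Sequent.replace_con]
      exact cutFree_of_derivableCuts ih (principal _ _ a R₁ inf₁ hinf₁ R inf hinf hc₁ hp₁ hprems₁
        hc hp hprems)
  -- Now the right premise is arbitrary: replacement in it by `x` leads back to `right`.
  have left : ∀ x, C.CutFreeDerivable ⟨x, .op a⟩ → ∀ s, C.CutFreeDerivable s → ∀ p,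
      s.sub p = some (.pre, .op a) → C.CutFreeDerivable (s.replace {p} x) := by
    intro x hx s hs p hp
    refine replace_cutFree shape nonprolif position quasiDisplay single displayInv substPre
      (a := a) hx.wellTyped.1 (uniform _ hx.derivable) ?_ hs {p} (by simpa using hp)
    intro R inf hinf hprems hp
    have hc := Sequent.ant_eq_of_sub hp.1
    rw [hc, Sequent.replace_ant]
    exact right R inf hinf hprems hp x hx
  rintro s₁ s₂ s₃ (⟨hcon, -, p, hp, rfl⟩ | ⟨hant, -, p, hp, rfl⟩) h₁ h₂
  · obtain ⟨x, _⟩ := s₁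
    obtain rfl := hcon
    exact left x h₁ s₂ h₂ p hp
  · obtain ⟨_, y⟩ := s₂
    obtain rfl := hant
    refine replace_cutFree shape nonprolif position quasiDisplay single displayInv substSuc
      (a := a) h₂.wellTyped.2 (uniform _ h₂.derivable).symm ?_ h₁ {p} (by simpa using hp)
    intro R inf hinf hprems hq
    have hc := Sequent.con_eq_of_sub hq.1
    have hd : C.CutFreeDerivable inf.concl := .rule R inf hinf hprems
    rw [hc] at hd ⊢
    rw [Sequent.replace_con]
    -- Once `a` is the whole succedent on the left, the right cut is an ordinary cut, hence also a
    -- left surgical cut.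
    have := left _ hd _ h₂ (.pre, []) (by simp [Sequent.sub, Str.sub])
    rwa [Sequent.replace_ant] at this

/-- By C₁ a property inherited by subterms passes from the conclusion of each rule to its premises,
hence up the whole derivation. -/
theorem PreservesOpTerms.cutFreeWithin (pres : C.PreservesOpTerms) {P : Op L → Prop}
    (hP : ∀ a b, P a → b.Subterm a → P b) {s : Sequent L} (hs : C.CutFreeDerivable s)
    (h : ∀ a, s.Occurs a → P a) : C.CutFreeWithin P s := by
  unfold CutFreeDerivable at hs
  induction hs with
  | lcut _ _ _ _ ha => exact ha.elim
  | rcut _ _ _ _ ha => exact ha.elim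
  | rule R inf hinf _ ih =>
    refine .rule R inf hinf h fun s hs => ih s hs fun b hb => ?_
    obtain ⟨a, ha, hba⟩ := pres R inf hinf s hs b hb
    exact hP a b (h a ha) hba

end Calculus

end MultiType

theorem theorem1 {L : MultiType.Language} (C : MultiType.Calculus L)
    (shape : C.ShapeAlike) (type : C.TypeAlike) (nonprolif : C.NonProliferation)
    (position : C.PositionAlike)
    (quasiDisplay : C.QuasiDisplay) (single : C.SinglePrincipal)
    (displayInv : C.DisplayInvariant) (cutClosed : C.AxiomsCutClosed)
    (substSuc : C.ClosedUnderSubst .suc) (substPre : C.ClosedUnderSubst .pre)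
    (principal : C.PrincipalCutsReduce)
    (uniform : C.DerivableTypeUniform) (cutUniform : MultiType.CutsPreserveTypeUniformity L) :
    (∀ s, C.Derivable s → C.CutFreeDerivable s) ∧
      (C.PreservesOpTerms → C.SubformulaProperty) := by
  have cutFree : ∀ s, C.Derivable s → C.CutFreeDerivable s := fun s hs =>
    MultiType.Calculus.cutFree_of_derivableCuts (fun a _ =>
      MultiType.Calculus.cut_admissible shape nonprolif position quasiDisplay single displayInv
        substSuc substPre principal uniform a) hs
  refine ⟨cutFree, fun pres s hs => pres.cutFreeWithin ?_ (cutFree s hs) fun a ha =>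
    ⟨a, ha, .refl⟩⟩
  rintro a b ⟨c, hc, hac⟩ hba
  exact ⟨c, hc, hba.trans hac⟩
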